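/- Let $A$ be a commutative ring. For a finitely generated ideal $\mathfrak a$ of $A$ write $\mathrm{Gr}(\mathfrak a)\ge 2$ if $\mathfrak a$ has (true) grade at least $2$: if $f_1,f_2$ are polynomials over $A$ in two disjoint sets of variables $X, Y$, each with coefficients generating $\mathfrak a$, then $f_1$ is a nonzerodivisor in $A[X,Y]$ and $f_2$ is a nonzerodivisor modulo $f_1$ (this does not depend on the choice of $f_1,f_2$). A finitely generated ideal $\mathfrak a$ is a MacRae ideal if there is a nonzerodivisor $e\in A$ with $\mathfrak a\subseteq\langle e\rangle$ and $\mathrm{Gr}(\mathfrak a/e)\ge 2$, where $\mathfrak a/e=\{x\in A: ex\in\mathfrak a\}$; the ideal $\langle e\rangle$ then depends only on $\mathfrak a$. An $A$-module $E$ is a MacRae module if it is finitely presented and its Fitting ideal $\mathcal F_0(E)$ (generated by the $q\times q$ minors of a presentation matrix of $E$ with $q$ generators) is a MacRae ideal; the ideal $\langle e\rangle$ associated with $\mathcal F_0(E)$ is called the MacRae invariant of $E$ and denoted $\mathfrak G(E)$. (1) Let $0\to E\to F\to G\to 0$ be a short exact sequence of finitely presented $A$-modules. If $E$ and $G$ are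 MacRae modules, then $F$ is a MacRae module and $\mathfrak G(E)\,\mathfrak G(G)=\mathfrak G(F)$. If $F$ and $G$ are MacRae modules, then $E$ is a MacRae module. (2) Let $n\ge 2$ and let $$E_{n-1}\xrightarrow{u_{n-1}}E_{n-2}\to\cdots\xrightarrow{u_1}E_0\to 0$$ be an exact sequence of $A$-modules in which $E_0,\dots,E_{n-1}$ are MacRae modules. Then $\ker u_i$ is a MacRae module for $1\le i\le n-3$. If moreover the module $E_n:=\ker u_{n-1}$ is finitely presented, then $\ker u_i$ is a MacRae module for every $1\le i\le n-1$, and $$\prod_{0\le 2i\le n}\mathfrak G(E_{2i})=\prod_{0\le 2i+1\le n}\mathfrak G(E_{2i+1}).$$ -/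

import Mathlib

/-- The content ideal of a polynomial `f`, generated by its coefficients. -/
def polyContent {A : Type*} [CommRing A] {σ : Type*} (f : MvPolynomial σ A) : Ideal A :=
  Ideal.span (Set.range fun d => MvPolynomial.coeff d f)

/-- `HasGradeGE k I`: the ideal `I` has (true) grade, or depth, at least `k`, i.e. `Gr(I) ≥ k`
in the sense of Hochster and Northcott. There is a Kronecker sequence `f 0, …, f (k - 1)` attached
to `I` (polynomials with content ideal `I`, in pairwise disjoint sets of variables) which is a
regular sequence in the polynomial ring. As usual in this theory, a regular sequence
may generate the unit ideal (`IsWeaklyRegular` in Mathlib). The variables of `f j` are the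
`X (j, i)`. The ring `A` is arbitrary, and the condition does not depend on the choice of the
Kronecker sequence. -/
def HasGradeGE {A : Type*} [CommRing A] (k : ℕ) (I : Ideal A) : Prop :=
  ∃ (m : ℕ) (f : Fin k → MvPolynomial (Fin m) A),
    (∀ j, polyContent (f j) = I) ∧
      RingTheory.Sequence.IsWeaklyRegular (MvPolynomial (Fin k × Fin m) A)
        (List.ofFn fun j : Fin k => MvPolynomial.rename (fun i : Fin m => (j, i)) (f j))

/-- The determinantal ideal of order `k` of a matrix, generated by its minors of order `k`.
(Repeated rows or columns only contribute the minor `0`, and reordering them only changes a sign.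
For `k = 0` this is the unit ideal.) -/
def determinantalIdeal {A : Type*} [CommRing A] {q m : ℕ} (k : ℕ)
    (M : Matrix (Fin q) (Fin m) A) : Ideal A :=
  Ideal.span {d | ∃ (r : Fin k → Fin q) (c : Fin k → Fin m), d = (M.submatrix r c).det}

/-- `M` is a presentation matrix of the module `E`: its columns generate the module of
relations of some generating family of `E` with `q` elements. -/
def IsPresentationMatrix {A : Type*} [CommRing A] {q m : ℕ} (M : Matrix (Fin q) (Fin m) A)
    (E : Type*) [AddCommGroup E] [Module A E] : Prop :=
  ∃ p : (Fin q → A) →ₗ[A] E,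
    Function.Surjective p ∧ Function.Exact M.mulVecLin p

/-- The `n`-th Fitting ideal of a finitely presented module `E`: the determinantal ideal of order
`q - n` of a presentation matrix of `E` with `q` rows. All presentation matrices give the same
ideal, so that the supremum is the common value. -/
def fittingIdeal (A : Type*) [CommRing A] (n : ℕ) (E : Type*) [AddCommGroup E] [Module A E] :
    Ideal A :=
  ⨆ (q : ℕ) (m : ℕ) (M : Matrix (Fin q) (Fin m) A) (_ : IsPresentationMatrix M E),
    determinantalIdeal (q - n) M

/-- `e` is a regular element with `I ⊆ ⟨e⟩` and `Gr(I / e) ≥ 2`, where `I / e` is the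
ideal `{x | e * x ∈ I}`. -/
def IsMacRaeDivisor {A : Type*} [CommRing A] (I : Ideal A) (e : A) : Prop :=
  e ∈ nonZeroDivisors A ∧ I ≤ Ideal.span {e} ∧
    HasGradeGE 2 (Submodule.comap (LinearMap.mulLeft A e) I)

/-- MacRae ideals. -/
def IsMacRaeIdeal {A : Type*} [CommRing A] (I : Ideal A) : Prop :=
  I.FG ∧ ∃ e : A, IsMacRaeDivisor I e

/-- MacRae modules: finitely presented modules whose Fitting ideal of order `0` is a
MacRae ideal. -/
def IsMacRaeModule (A : Type*) [CommRing A] (E : Type*) [AddCommGroup E] [Module A E] : Prop :=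
  Module.FinitePresentation A E ∧ IsMacRaeIdeal (fittingIdeal A 0 E)

/-- The MacRae invariant of a MacRae module `E`: the principal ideal `⟨e⟩`, where `e` is such that
`F₀(E) ⊆ ⟨e⟩` and `Gr(F₀(E) / e) ≥ 2`. Such an `e` is unique up to a unit,
so that the set below generates the ideal `⟨e⟩` for any one of its elements. -/
def macRaeInvariant (A : Type*) [CommRing A] (E : Type*) [AddCommGroup E] [Module A E] :
    Ideal A :=
  Ideal.span {e | IsMacRaeDivisor (fittingIdeal A 0 E) e}

/-! Two reformulations carry the proof. The ideal F₀(E) is generated by the determinants of square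
matrices whose columns are relations between the members of any finite generating family
(`fittingIdeal_zero_eq`). Grade at least 2, for a finitely generated I, amounts to
`IsKoszulGradeTwo`: Hom(A/I, A) = Ext¹(A/I, A) = 0. This condition passes to larger ideals and to
products, and it permits cancellation: if I x ⊆ (z) with z regular, then x ∈ (z).

For 0 → E → F → G → 0, join generators of E to lifts of generators of G. Block triangular
determinants give F₀(E) F₀(G) ⊆ F₀(F) ⊆ F₀(G). The key is a partial converse (`pow_mul_det_mem`): if
F₀(G) ⊆ (c) with c regular and c b is the determinant of a matrix of relations of G, Cramer's rule
gives bⁿ F₀(F) ⊆ c b F₀(E). The elements b generate F₀(G)/c, and their n-th powers still generate an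
ideal of grade at least 2 (`IsKoszulGradeTwo.span_pow`). Cancelling such ideals gives the required
divisibilities, and products of them give the required lower bounds on grades.

A long exact sequence is cut into short ones 0 → ker u_{i+1} → E_{i+2} → ker u_i → 0, whose
invariants are multiplied together. -/

/-! ### Fitting ideals as determinants of relations -/

section JoinMap

variable {A : Type*} [CommRing A] {ι κ E : Type*} [AddCommGroup E] [Module A E]

/-- The family of generators obtained by joining two families. -/
def joinMap (p : (ι → A) →ₗ[A] E) (p' : (κ → A) →ₗ[A] E) : (ι ⊕ κ → A) →ₗ[A] E :=
  p ∘ₗ LinearMap.funLeft A A Sum.inl + p' ∘ₗ LinearMap.funLeft A A Sum.inr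

theorem joinMap_apply (p : (ι → A) →ₗ[A] E) (p' : (κ → A) →ₗ[A] E) (v : ι ⊕ κ → A) :
    joinMap p p' v = p (fun i => v (Sum.inl i)) + p' (fun i => v (Sum.inr i)) := rfl

end JoinMap

section DetIdeal

variable {A : Type*} [CommRing A] {ι κ : Type*} [Fintype ι] [DecidableEq ι] [Fintype κ]
  [DecidableEq κ]

/-- The ideal generated by the determinants of the square matrices with columns in `K`. -/
def detIdeal (K : Submodule A (ι → A)) : Ideal A :=
  Ideal.span {d | ∃ M : Matrix ι ι A, (∀ j, (fun i => M i j) ∈ K) ∧ d = M.det}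

theorem det_mem_detIdeal {K : Submodule A (ι → A)} {M : Matrix ι ι A}
    (h : ∀ j, (fun i => M i j) ∈ K) : M.det ∈ detIdeal K :=
  Ideal.subset_span ⟨M, h, rfl⟩

theorem detIdeal_le {K : Submodule A (ι → A)} {I : Ideal A}
    (h : ∀ M : Matrix ι ι A, (∀ j, (fun i => M i j) ∈ K) → M.det ∈ I) : detIdeal K ≤ I := by
  refine Ideal.span_le.2 ?_
  rintro _ ⟨M, hM, rfl⟩
  exact h M hM

theorem det_mem_detIdeal_of_castAdd {p : ℕ} (K : Submodule A (Fin p → A)) (q : ℕ)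
    (M : Matrix (Fin (p + q)) (Fin (p + q)) A)
    (h : ∀ j, (fun i => M (Fin.castAdd q i) j) ∈ K) : M.det ∈ detIdeal K := by
  induction q with
  | zero => exact det_mem_detIdeal h
  | succ q ih =>
    rw [Matrix.det_succ_row M (Fin.last (p + q))]
    refine Ideal.sum_mem _ fun j _ => Ideal.mul_mem_left _ _ (ih _ fun k => ?_)
    have e : ∀ i : Fin p, (Fin.last (p + q)).succAbove (Fin.castAdd q i) = Fin.castAdd (q + 1) i :=
      fun i => by rw [Fin.succAbove_last]; rfl
    convert h (j.succAbove k) using 2 with i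
    exact congrArg (fun x => M x (j.succAbove k)) (e i)

/-- A Laplace expansion: the determinant lies in `detIdeal K` as soon as the restrictions of the
columns to some of the rows lie in `K`. -/
theorem det_mem_detIdeal_of_inl (K : Submodule A (ι → A)) (M : Matrix (ι ⊕ κ) (ι ⊕ κ) A)
    (h : ∀ j, (fun i => M (Sum.inl i) j) ∈ K) : M.det ∈ detIdeal K := by
  let e := Fintype.equivFin ι
  let σ : Fin (Fintype.card ι + Fintype.card κ) ≃ ι ⊕ κ :=
    finSumFinEquiv.symm.trans (Equiv.sumCongr e.symm (Fintype.equivFin κ).symm)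
  have h1 : (M.submatrix σ σ).det ∈ detIdeal (K.comap (LinearMap.funLeft A A e)) := by
    refine det_mem_detIdeal_of_castAdd _ _ _ fun j => ?_
    rw [Submodule.mem_comap]
    convert h (σ j) using 2 with i
    simp [σ, LinearMap.funLeft_apply]
  rw [Matrix.det_submatrix_equiv_self] at h1
  refine detIdeal_le (fun N hN => ?_) h1
  rw [← Matrix.det_submatrix_equiv_self e N]
  exact det_mem_detIdeal fun j => hN (e j)

theorem det_mem_detIdeal_of_inr (K : Submodule A (κ → A)) (M : Matrix (ι ⊕ κ) (ι ⊕ κ) A)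
    (h : ∀ j, (fun i => M (Sum.inr i) j) ∈ K) : M.det ∈ detIdeal K := by
  rw [← Matrix.det_submatrix_equiv_self (Equiv.sumComm κ ι) M]
  exact det_mem_detIdeal_of_inl K _ fun j => h _

theorem detIdeal_comap_funLeft_le (e : ι ≃ κ) (K : Submodule A (κ → A)) :
    detIdeal (K.comap (LinearMap.funLeft A A e.symm)) ≤ detIdeal K := by
  refine detIdeal_le fun N hN => ?_
  rw [← Matrix.det_submatrix_equiv_self e.symm N]
  exact det_mem_detIdeal fun j => hN (e.symm j)

variable {E : Type*} [AddCommGroup E] [Module A E]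

/-- The extra generators are p' = p ∘ H. Left multiplication by the unipotent block matrix (1 H; 0
1) turns the upper rows into relations of p, and Laplace expansion applies. Conversely, N is
completed to (N −H; 0 1), with the same determinant. -/
theorem detIdeal_ker_joinMap (p : (ι → A) →ₗ[A] E) (p' : (κ → A) →ₗ[A] E)
    (hp : Function.Surjective p) :
    detIdeal (LinearMap.ker (joinMap p p')) = detIdeal (LinearMap.ker p) := by
  obtain ⟨h, hh⟩ := Module.projective_lifting_property p p' hp
  have hH : ∀ v, p ((LinearMap.toMatrix' h).mulVec v) = p' v := fun v => by
    rw [LinearMap.toMatrix'_mulVec, ← hh]; rfl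
  set H := LinearMap.toMatrix' h
  apply le_antisymm
  · refine detIdeal_le fun M hM => ?_
    have : M.det = (Matrix.fromBlocks 1 H 0 1 * M).det := by simp
    rw [this]
    refine det_mem_detIdeal_of_inl _ _ fun j => ?_
    have := hM j
    rw [LinearMap.mem_ker, joinMap_apply, ← hH, ← map_add] at this
    rw [LinearMap.mem_ker, ← this]
    congr 1
    ext i
    simp [Matrix.mul_apply, Matrix.mulVec, dotProduct, Matrix.one_apply]
  · refine detIdeal_le fun N hN => ?_
    have : N.det = (Matrix.fromBlocks N (-H) 0 (1 : Matrix κ κ A)).det := by simp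
    rw [this]
    refine det_mem_detIdeal fun j => ?_
    rw [LinearMap.mem_ker, joinMap_apply]
    rcases j with j | j
    · exact (congrArg₂ (· + ·) (hN j) (map_zero p')).trans (add_zero 0)
    · rw [← hH, ← map_add]
      convert map_zero p
      ext i
      simp [Matrix.mulVec, dotProduct, Matrix.one_apply]

theorem detIdeal_ker_joinMap_comm_le (p : (ι → A) →ₗ[A] E) (p' : (κ → A) →ₗ[A] E) :
    detIdeal (LinearMap.ker (joinMap p p')) ≤ detIdeal (LinearMap.ker (joinMap p' p)) := by
  refine le_trans (le_of_eq ?_) (detIdeal_comap_funLeft_le (Equiv.sumComm ι κ) _)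
  congr 1
  ext v
  simp [joinMap_apply, LinearMap.funLeft_apply, add_comm]

theorem detIdeal_ker_eq (p : (ι → A) →ₗ[A] E) (p' : (κ → A) →ₗ[A] E)
    (hp : Function.Surjective p) (hp' : Function.Surjective p') :
    detIdeal (LinearMap.ker p) = detIdeal (LinearMap.ker p') := by
  rw [← detIdeal_ker_joinMap p p' hp, ← detIdeal_ker_joinMap p' p hp']
  exact le_antisymm (detIdeal_ker_joinMap_comm_le _ _) (detIdeal_ker_joinMap_comm_le _ _)

theorem determinantalIdeal_eq_detIdeal {q m : ℕ} (M : Matrix (Fin q) (Fin m) A) :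
    determinantalIdeal q M = detIdeal (LinearMap.range M.mulVecLin) := by
  apply le_antisymm
  · refine Ideal.span_le.2 ?_
    rintro _ ⟨r, c, rfl⟩
    -- Factoring out the row selection, which need not be injective, leaves full columns of M.
    have : M.submatrix r c = (1 : Matrix (Fin q) (Fin q) A).submatrix r id * M.submatrix id c := by
      ext i j
      simp [Matrix.mul_apply, Matrix.one_apply]
    rw [this, Matrix.det_mul]
    refine Ideal.mul_mem_left _ _ (det_mem_detIdeal fun j => ⟨Pi.single (c j) 1, ?_⟩)
    ext i
    simp
  · refine detIdeal_le fun N hN => ?_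
    choose X hX using hN
    have : N.det = Matrix.detRowAlternating (fun j => ∑ k, X j k • fun i => M i k) := by
      rw [← Matrix.det_transpose]
      congr 1
      ext j i
      rw [Matrix.transpose_apply, ← congrFun (hX j) i]
      simp [Matrix.mulVec, dotProduct, mul_comm]
    rw [this]
    -- Each column of N is a combination of columns of M; multilinearity expands the determinant
    -- into maximal minors of M.
    rw [← AlternatingMap.coe_multilinearMap, MultilinearMap.map_sum]
    refine Ideal.sum_mem _ fun c _ => ?_
    rw [MultilinearMap.map_smul_univ]
    refine Ideal.mul_mem_left _ _ (Ideal.subset_span ⟨id, c, ?_⟩)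
    rw [← Matrix.det_transpose]
    rfl

theorem exists_isPresentationMatrix (A : Type*) [CommRing A] (E : Type*) [AddCommGroup E]
    [Module A E] [Module.FinitePresentation A E] :
    ∃ (q m : ℕ) (M : Matrix (Fin q) (Fin m) A), IsPresentationMatrix M E := by
  obtain ⟨q, p, hp⟩ := Module.Finite.exists_fin' A E
  obtain ⟨m, r, hr⟩ := Submodule.fg_iff_exists_fin_linearMap _ _ |>.1
    (Module.FinitePresentation.fg_ker p hp)
  refine ⟨q, m, LinearMap.toMatrix' r, p, hp, LinearMap.exact_iff.2 ?_⟩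
  rw [← Matrix.toLin'_apply', Matrix.toLin'_toMatrix', hr]

/-- The `0`-th Fitting ideal can be computed from any finite family of generators. -/
theorem fittingIdeal_zero_eq [Module.FinitePresentation A E] (p : (ι → A) →ₗ[A] E)
    (hp : Function.Surjective p) : fittingIdeal A 0 E = detIdeal (LinearMap.ker p) := by
  have key : ∀ (q m : ℕ) (M : Matrix (Fin q) (Fin m) A), IsPresentationMatrix M E →
      determinantalIdeal (q - 0) M = detIdeal (LinearMap.ker p) := by
    rintro q m M ⟨p', hp', hM⟩
    have := determinantalIdeal_eq_detIdeal M
    rw [← LinearMap.exact_iff.1 hM, detIdeal_ker_eq p' p hp' hp] at this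
    exact this
  apply le_antisymm
  · exact iSup_le fun q => iSup_le fun m => iSup_le fun M => iSup_le fun h => (key q m M h).le
  · obtain ⟨q, m, M, hM⟩ := exists_isPresentationMatrix A E
    rw [← key q m M hM]
    exact le_iSup_of_le q (le_iSup_of_le m (le_iSup_of_le M (le_iSup_of_le hM le_rfl)))

theorem fittingIdeal_zero_fg (A : Type*) [CommRing A] (E : Type*) [AddCommGroup E]
    [Module A E] [Module.FinitePresentation A E] : (fittingIdeal A 0 E).FG := by
  obtain ⟨q, m, M, p, hp, hM⟩ := exists_isPresentationMatrix A E
  rw [fittingIdeal_zero_eq p hp, LinearMap.exact_iff.1 hM, ← determinantalIdeal_eq_detIdeal]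
  refine Submodule.fg_span ((Set.finite_range fun rc : (Fin q → Fin q) × (Fin q → Fin m) =>
    (M.submatrix rc.1 rc.2).det).subset ?_)
  rintro _ ⟨r, c, rfl⟩
  exact ⟨(r, c), rfl⟩

end DetIdeal

/-! ### Relations and determinants in a short exact sequence -/

section ShortExact

variable {A : Type*} [CommRing A] {ι κ E F G : Type*} [AddCommGroup E] [Module A E]
  [AddCommGroup F] [Module A F] [AddCommGroup G] [Module A G] {f : E →ₗ[A] F} {g : F →ₗ[A] G}

theorem joinMap_surjective (hfg : Function.Exact f g) (p : (ι → A) →ₗ[A] E)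
    (p' : (κ → A) →ₗ[A] F) (hp : Function.Surjective p) (hp' : Function.Surjective (g ∘ₗ p')) :
    Function.Surjective (joinMap (f ∘ₗ p) p') := by
  intro y
  obtain ⟨w, hw⟩ := hp' (g y)
  obtain ⟨x, hx⟩ := (hfg (y - p' w)).1 (by rw [map_sub, ← hw]; exact sub_self _)
  obtain ⟨v, rfl⟩ := hp x
  refine ⟨Sum.elim v w, ?_⟩
  rw [joinMap_apply]
  simp [hx]

theorem inr_mem_ker (hfg : Function.Exact f g) {p : (ι → A) →ₗ[A] E}
    {p' : (κ → A) →ₗ[A] F} {v : ι ⊕ κ → A} (hv : v ∈ LinearMap.ker (joinMap (f ∘ₗ p) p')) :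
    (fun i => v (Sum.inr i)) ∈ LinearMap.ker (g ∘ₗ p') := by
  have := congrArg g (LinearMap.mem_ker.1 hv)
  rw [joinMap_apply, map_add, LinearMap.comp_apply, hfg.apply_apply_eq_zero, zero_add,
    map_zero] at this
  exact this

theorem exists_lift_mem_ker (hfg : Function.Exact f g) {p : (ι → A) →ₗ[A] E}
    (hp : Function.Surjective p) {p' : (κ → A) →ₗ[A] F} {w : κ → A}
    (hw : w ∈ LinearMap.ker (g ∘ₗ p')) :
    ∃ v : ι → A, Sum.elim v w ∈ LinearMap.ker (joinMap (f ∘ₗ p) p') := by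
  obtain ⟨x, hx⟩ := (hfg (p' w)).1 hw
  obtain ⟨v, rfl⟩ := hp x
  refine ⟨-v, ?_⟩
  rw [LinearMap.mem_ker, joinMap_apply]
  change f (p (-v)) + p' w = 0
  rw [map_neg, map_neg, hx, neg_add_cancel]

theorem inl_mem_ker (hf : Function.Injective f) {p : (ι → A) →ₗ[A] E}
    {p' : (κ → A) →ₗ[A] F} {v : ι → A}
    (hv : Sum.elim v 0 ∈ LinearMap.ker (joinMap (f ∘ₗ p) p')) : v ∈ LinearMap.ker p := by
  rw [LinearMap.mem_ker, joinMap_apply] at hv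
  exact hf ((add_zero _).symm.trans ((congrArg _ (map_zero p').symm).trans
    (hv.trans (map_zero f).symm)))

variable [Fintype ι] [DecidableEq ι] [Fintype κ] [DecidableEq κ]

theorem detIdeal_ker_joinMap_le (hfg : Function.Exact f g) (p : (ι → A) →ₗ[A] E)
    (p' : (κ → A) →ₗ[A] F) :
    detIdeal (LinearMap.ker (joinMap (f ∘ₗ p) p')) ≤ detIdeal (LinearMap.ker (g ∘ₗ p')) :=
  detIdeal_le fun _ hM => det_mem_detIdeal_of_inr _ _ fun j => inr_mem_ker hfg (hM j)

theorem detIdeal_ker_mul_le (hfg : Function.Exact f g) (p : (ι → A) →ₗ[A] E)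
    (hp : Function.Surjective p) (p' : (κ → A) →ₗ[A] F) :
    detIdeal (LinearMap.ker p) * detIdeal (LinearMap.ker (g ∘ₗ p')) ≤
      detIdeal (LinearMap.ker (joinMap (f ∘ₗ p) p')) := by
  rw [detIdeal, detIdeal, Ideal.span_mul_span', Ideal.span_le]
  rintro _ ⟨_, ⟨M, hM, rfl⟩, _, ⟨N, hN, rfl⟩, rfl⟩
  choose Z hZ using fun j => exists_lift_mem_ker hfg hp (hN j)
  have : M.det * N.det = (Matrix.fromBlocks M (Matrix.of fun i j => Z j i) 0 N).det := by simp
  simp only [this, SetLike.mem_coe]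
  refine det_mem_detIdeal fun j => ?_
  rcases j with j | j
  · rw [LinearMap.mem_ker, joinMap_apply]
    have h1 : (f ∘ₗ p) (fun i => M i j) = 0 := by
      rw [LinearMap.comp_apply, LinearMap.mem_ker.1 (hM j), map_zero]
    exact (congrArg₂ (· + ·) h1 (map_zero p')).trans (add_zero 0)
  · convert hZ j using 1
    ext i
    rcases i with i | i <;> simp

/-- Cramer's rule for the relations between generators, when the determinantal ideal is contained
in a principal ideal generated by a regular element. -/
theorem smul_mem_range_of_det_eq {K : Submodule A (κ → A)} {c b : A} (hc : c ∈ nonZeroDivisors A)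
    (hK : detIdeal K ≤ Ideal.span {c}) {N : Matrix κ κ A} (hN : ∀ j, (fun i => N i j) ∈ K)
    (hb : N.det = c * b) {w : κ → A} (hw : w ∈ K) : ∃ v, N.mulVec v = b • w := by
  -- The Cramer determinants replace a column of N by w ∈ K, so they are divisible by c; then c
  -- cancels in N (c v) = c b w.
  have h1 : ∀ i, ∃ v, N.cramer w i = c * v := fun i => by
    refine Ideal.mem_span_singleton.1 (hK ?_)
    rw [Matrix.cramer_apply]
    refine det_mem_detIdeal fun j => ?_
    by_cases hj : j = i
    · subst hj
      simpa using hw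
    · simpa [Matrix.updateCol_apply, hj] using hN j
  choose v hv using h1
  refine ⟨v, ?_⟩
  have h2 := Matrix.mulVec_cramer N w
  have h3 : N.cramer w = c • v := funext hv
  rw [h3, hb, Matrix.mulVec_smul, mul_smul] at h2
  ext i
  exact (mul_cancel_left_mem_nonZeroDivisors hc).1 (congrFun h2 i)

/-- The comparison of the Fitting ideals in a short exact sequence. -/
theorem pow_mul_det_mem (hf : Function.Injective f) (hfg : Function.Exact f g)
    (p : (ι → A) →ₗ[A] E) (hp : Function.Surjective p) (p' : (κ → A) →ₗ[A] F) {c b : A}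
    (hc : c ∈ nonZeroDivisors A)
    (hK : detIdeal (LinearMap.ker (g ∘ₗ p')) ≤ Ideal.span {c}) {N : Matrix κ κ A}
    (hN : ∀ j, (fun i => N i j) ∈ LinearMap.ker (g ∘ₗ p')) (hb : N.det = c * b)
    {M : Matrix (ι ⊕ κ) (ι ⊕ κ) A}
    (hM : ∀ j, (fun i => M i j) ∈ LinearMap.ker (joinMap (f ∘ₗ p) p')) :
    ∃ d ∈ detIdeal (LinearMap.ker p), b ^ Fintype.card (ι ⊕ κ) * M.det = c * b * d := by
  choose Z hZ using fun j => exists_lift_mem_ker hfg hp (hN j)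
  choose V hV using fun j => smul_mem_range_of_det_eq hc hK hN hb (inr_mem_ker hfg (hM j))
  let Z' : Matrix ι κ A := Matrix.of fun i j => Z j i
  let V' : Matrix κ (ι ⊕ κ) A := Matrix.of fun i j => V j i
  let R : Matrix ι (ι ⊕ κ) A := b • M.submatrix Sum.inl id - Z' * V'
  have hNV : N * V' = b • M.submatrix Sum.inr id := by
    ext i j
    simpa [Matrix.mulVec, dotProduct, Matrix.mul_apply, V'] using congrFun (hV j) i
  -- Determinants of this identity give the result; the exponent of b is the size of M.
  have hmul : Matrix.fromBlocks 1 Z' 0 N * Matrix.fromRows R V' = b • M := by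
    rw [Matrix.fromBlocks_mul_fromRows, hNV]
    ext i j
    rcases i with i | i <;> simp [R]
  refine ⟨(Matrix.fromRows R V').det, det_mem_detIdeal_of_inl _ _ fun j => ?_, ?_⟩
  -- A column of R, padded with zeros, is b times a column of M minus a combination of lifted
  -- columns of N. It is thus a relation in F, and injectivity of f makes it one in E.
  · refine inl_mem_ker hf (p' := p') ?_
    have : Sum.elim (fun i => Matrix.fromRows R V' (Sum.inl i) j) 0 =
        b • (fun i => M i j) - ∑ k, V j k • Sum.elim (Z k) (fun i => N i k) := by
      ext i
      rcases i with i | i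
      · simp [R, Matrix.mul_apply, Z', V', mul_comm]
      · have := congrFun (hV j) i
        simp only [Matrix.mulVec, dotProduct, Pi.smul_apply, smul_eq_mul] at this
        simp [← this, mul_comm]
    rw [this]
    exact Submodule.sub_mem _ (Submodule.smul_mem _ _ (hM j))
      (Submodule.sum_mem _ fun k _ => Submodule.smul_mem _ _ (hZ k))
  · rw [← Matrix.det_smul, ← hmul, Matrix.det_mul]
    simp [hb]

end ShortExact

/-! ### Grade at least two as a Hom and Ext¹ condition -/

section KoszulGrade

variable {A : Type*} [CommRing A]

/-- The vanishing of `Hom(A/I, A)` and `Ext¹(A/I, A)`: no nonzero element is killed by `I`, and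
every family indexed by `I` and proportional to `I` is a multiple of it. -/
def IsKoszulGradeTwo (I : Ideal A) : Prop :=
  (∀ x, (∀ a ∈ I, a * x = 0) → x = 0) ∧
    ∀ w : A → A, (∀ a ∈ I, ∀ b ∈ I, a * w b = b * w a) → ∃ c, ∀ a ∈ I, w a = c * a

namespace IsKoszulGradeTwo

variable {I J : Ideal A}

theorem top : IsKoszulGradeTwo (⊤ : Ideal A) :=
  ⟨fun x hx => by simpa using hx 1 trivial, fun w hw =>
    ⟨w 1, fun a _ => by linear_combination hw 1 trivial a trivial⟩⟩

theorem mono (hI : IsKoszulGradeTwo I) (h : I ≤ J) : IsKoszulGradeTwo J := by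
  refine ⟨fun x hx => hI.1 x fun a ha => hx a (h ha), fun w hw => ?_⟩
  obtain ⟨c, hc⟩ := hI.2 w fun a ha b hb => hw a (h ha) b (h hb)
  refine ⟨c, fun b hb => sub_eq_zero.1 (hI.1 _ fun a ha => ?_)⟩
  linear_combination hw a (h ha) b hb + b * hc a ha

theorem mul (hI : IsKoszulGradeTwo I) (hJ : IsKoszulGradeTwo J) : IsKoszulGradeTwo (I * J) := by
  have hann : ∀ x, (∀ a ∈ I * J, a * x = 0) → x = 0 := fun x hx =>
    hJ.1 x fun b hb => hI.1 _ fun a ha => by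
      linear_combination hx (a * b) (Ideal.mul_mem_mul ha hb)
  refine ⟨hann, fun w hw => ?_⟩
  -- No linearity of w is assumed: proportionality and the zero annihilator force homogeneity on I *
  -- J.
  have hlin : ∀ x y, x ∈ I * J → y * x ∈ I * J → w (y * x) = y * w x := fun x y hx hy =>
    sub_eq_zero.1 (hann _ fun t ht => by
      linear_combination hw t ht (y * x) hy - y * hw t ht x hx)
  -- For fixed b ∈ J, the map a ↦ w (a b) is multiplication by some c b on I; then c is itself
  -- proportional to J.
  have h1 : ∀ b ∈ J, ∃ c, ∀ a ∈ I, w (a * b) = c * a := fun b hb =>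
    hI.2 (fun a => w (a * b)) fun a ha a' ha' => by
      have e1 := hlin (a' * b) a (Ideal.mul_mem_mul ha' hb)
        (Ideal.mul_mem_left _ _ (Ideal.mul_mem_mul ha' hb))
      have e2 := hlin (a * b) a' (Ideal.mul_mem_mul ha hb)
        (Ideal.mul_mem_left _ _ (Ideal.mul_mem_mul ha hb))
      rw [← e1, ← e2, mul_left_comm]
  choose! c hc using h1
  obtain ⟨d, hd⟩ := hJ.2 c fun b hb b' hb' => sub_eq_zero.1 (hI.1 _ fun a ha => by
      have e1 := hlin (a * b') b (Ideal.mul_mem_mul ha hb')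
        (Ideal.mul_mem_left _ _ (Ideal.mul_mem_mul ha hb'))
      have e2 := hlin (a * b) b' (Ideal.mul_mem_mul ha hb)
        (Ideal.mul_mem_left _ _ (Ideal.mul_mem_mul ha hb))
      rw [show b' * (a * b) = b * (a * b') by ring] at e2
      linear_combination e2 - e1 + b' * hc b hb a ha - b * hc b' hb' a ha)
  refine ⟨d, fun t ht => sub_eq_zero.1 (hJ.1 _ fun b hb => hI.1 _ fun a ha => ?_)⟩
  have hab := Ideal.mul_mem_mul ha hb
  linear_combination hw (a * b) hab t ht + t * hc b hb a ha + t * a * hd b hb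

theorem pow (hI : IsKoszulGradeTwo I) (n : ℕ) : IsKoszulGradeTwo (I ^ n) := by
  induction n with
  | zero => simpa using top
  | succ n ih => exact pow_succ I n ▸ ih.mul hI

theorem mem_span_singleton (hI : IsKoszulGradeTwo I) {z x : A} (hz : z ∈ nonZeroDivisors A)
    (h : ∀ a ∈ I, a * x ∈ Ideal.span {z}) : x ∈ Ideal.span {z} := by
  have h' : ∀ a ∈ I, ∃ v, v * z = a * x := fun a ha => Ideal.mem_span_singleton'.1 (h a ha)
  choose! v hv using h'
  obtain ⟨c, hc⟩ := hI.2 v fun a ha b hb =>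
    (mul_cancel_left_mem_nonZeroDivisors hz).1 (by linear_combination a * hv b hb - b * hv a ha)
  refine Ideal.mem_span_singleton'.2 ⟨c, sub_eq_zero.1 (hI.1 _ fun a ha => ?_)⟩
  linear_combination hv a ha - z * hc a ha

/-- The generators lie in the radical of the ideal of their n-th powers, so by finite generation
some power of the original ideal lies in it. -/
theorem span_pow {S : Set A} (hS : IsKoszulGradeTwo (Ideal.span S)) (hfg : (Ideal.span S).FG)
    (n : ℕ) : IsKoszulGradeTwo (Ideal.span ((· ^ n) '' S)) := by
  obtain ⟨N, hN⟩ := Ideal.exists_pow_le_of_le_radical_of_fg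
    (J := Ideal.span ((· ^ n) '' S)) (Ideal.span_le.2 fun b hb =>
      ⟨n, Ideal.subset_span ⟨b, hb, rfl⟩⟩) hfg
  exact (hS.pow N).mono hN

/-- A family given on generators is extended to the ideal by choosing coordinates of each element;
the choice need not be linear, since only proportionality is needed. -/
theorem exists_eq_mul_of_family {ι : Type*} {a : ι → A}
    (ha : IsKoszulGradeTwo (Ideal.span (Set.range a))) {v : ι → A}
    (hv : ∀ i j, a i * v j = a j * v i) : ∃ c, ∀ i, v i = c * a i := by
  have h1 : ∀ y ∈ Ideal.span (Set.range a), ∃ r : ι →₀ A, r.sum (fun i x => x * a i) = y :=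
    fun y hy => Finsupp.mem_span_range_iff_exists_finsupp.1 hy
  choose! r hr using h1
  have hcomm : ∀ i, ∀ y ∈ Ideal.span (Set.range a),
      a i * (r y).sum (fun i x => x * v i) = y * v i := fun i y hy => by
    conv_rhs => rw [← hr y hy]
    rw [Finsupp.sum, Finsupp.sum, Finset.mul_sum, Finset.sum_mul]
    exact Finset.sum_congr rfl fun j _ => by linear_combination r y j * hv i j
  obtain ⟨c, hc⟩ := ha.2 (fun y => (r y).sum fun i x => x * v i) fun y hy z hz => by
    conv_lhs => rw [← hr y hy, Finsupp.sum, Finset.sum_mul]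
    conv_rhs => rw [Finsupp.sum, Finset.mul_sum]
    exact Finset.sum_congr rfl fun j _ => by linear_combination r y j * hcomm j z hz
  refine ⟨c, fun i => sub_eq_zero.1 (ha.1 _ fun y hy => ?_)⟩
  linear_combination a i * hc y hy - hcomm i y hy

end IsKoszulGradeTwo

open scoped Pointwise in
theorem isWeaklyRegular_pair_iff {R : Type*} [CommRing R] (a b : R) :
    RingTheory.Sequence.IsWeaklyRegular R [a, b] ↔
      (∀ x, a * x = 0 → x = 0) ∧ ∀ x y, b * x = a * y → ∃ z, x = a * z := by
  rw [RingTheory.Sequence.isWeaklyRegular_cons_iff,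
    RingTheory.Sequence.isWeaklyRegular_singleton_iff]
  refine and_congr isSMulRegular_iff_right_eq_zero_of_smul
    ((isSMulRegular_quotient_iff_mem_of_smul_mem (a • (⊤ : Submodule R R)) b).trans ?_)
  simp only [Submodule.mem_smul_pointwise_iff_exists, smul_eq_mul, Submodule.mem_top, true_and]
  constructor
  · intro h x y hxy
    obtain ⟨z, hz⟩ := h x ⟨y, hxy.symm⟩
    exact ⟨z, hz.symm⟩
  · rintro h x ⟨y, hy⟩
    obtain ⟨z, hz⟩ := h x y hy.symm
    exact ⟨z, hz.symm⟩

/-! ### McCoy's theorem and regularity modulo a polynomial -/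

section Polynomial

open Polynomial

variable {f : A[X]}

theorem mem_nonZeroDivisors_of_isKoszulGradeTwo
    (hf : IsKoszulGradeTwo (Ideal.span (Set.range f.coeff))) : f ∈ nonZeroDivisors A[X] := by
  refine Polynomial.mem_nonZeroDivisors_iff.2 fun r hr => hf.1 r fun a ha => ?_
  induction ha using Submodule.span_induction with
  | mem x hx =>
    obtain ⟨k, rfl⟩ := hx
    rw [mul_comm, ← smul_eq_mul, ← Polynomial.coeff_smul, hr, Polynomial.coeff_zero]
  | zero => exact zero_mul r
  | add x y _ _ hx hy => rw [add_mul, hx, hy, add_zero]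
  | smul c x _ hx => rw [smul_eq_mul, mul_assoc, hx, mul_zero]

/-- Write f_k y = f w_k. Regularity of f makes the w_k proportional to the f_k, so w_k = f_k q
coefficientwise, and all f_k kill y − f q. -/
theorem dvd_of_forall_coeff_mul (hf : IsKoszulGradeTwo (Ideal.span (Set.range f.coeff)))
    {y : A[X]} (h : ∀ k, f ∣ C (f.coeff k) * y) : f ∣ y := by
  have hreg := mem_nonZeroDivisors_of_isKoszulGradeTwo hf
  have hann : ∀ x, (∀ k, f.coeff k * x = 0) → x = 0 := fun x hx => hf.1 x fun a ha => by
    have : Ideal.span (Set.range f.coeff) ≤ LinearMap.ker (LinearMap.mulRight A x) := by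
      refine Ideal.span_le.2 ?_
      rintro _ ⟨k, rfl⟩
      exact hx k
    exact this ha
  choose w hw using h
  have hsym : ∀ t j k, f.coeff j * (w k).coeff t = f.coeff k * (w j).coeff t := fun t j k => by
    rw [← coeff_C_mul, ← coeff_C_mul]
    congr 1
    refine (mul_cancel_left_mem_nonZeroDivisors hreg).1 ?_
    linear_combination C (f.coeff k) * hw j - C (f.coeff j) * hw k
  choose c hc using fun t => hf.exists_eq_mul_of_family (hsym t)
  let S : Finset ℕ := f.support.biUnion fun k => (w k).support
  -- Outside S every `w k` has zero coefficient, so c t is killed by all coefficients of f; hence q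
  -- is a polynomial.
  have hS : ∀ t, t ∉ S → c t = 0 := fun t ht => hann _ fun k => by
    by_cases hk : k ∈ f.support
    · have : (w k).coeff t = 0 := by
        by_contra h0
        exact ht (Finset.mem_biUnion.2 ⟨k, hk, mem_support_iff.2 h0⟩)
      rw [mul_comm, ← hc, this]
    · rw [notMem_support_iff.1 hk, zero_mul]
  let q : A[X] := ∑ t ∈ S, monomial t (c t)
  have hq : ∀ t, q.coeff t = c t := fun t => by
    simp only [q, finsetSum_coeff, coeff_monomial, Finset.sum_ite_eq']
    split_ifs with h
    · rfl
    · exact (hS t h).symm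
  have hwq : ∀ k, w k = C (f.coeff k) * q := fun k => by
    ext t
    rw [coeff_C_mul, hq, hc, mul_comm]
  refine ⟨q, ?_⟩
  ext t
  refine sub_eq_zero.1 (hann _ fun k => ?_)
  rw [mul_sub, ← coeff_C_mul, ← coeff_C_mul, hw k, hwq k, sub_eq_zero]
  congr 1
  ring

/-- `C f` is f(X) and `f.map C` is f(Y). McCoy's theorem over B = A[X]/(f) reduces regularity of
f(Y) modulo f(X) to `dvd_of_forall_coeff_mul`. -/
theorem exists_eq_C_mul_of_surjective {B : Type*} [CommRing B] (π : A[X] →+* B)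
    (hs : Function.Surjective π) (hπ : ∀ z, π z = 0 ↔ f ∣ z)
    (hf : IsKoszulGradeTwo (Ideal.span (Set.range f.coeff)))
    {x y : A[X][X]} (h : f.map C * x = C f * y) : ∃ z, x = C f * z := by
  have hreg : (f.map C).map π ∈ nonZeroDivisors B[X] := by
    refine Polynomial.mem_nonZeroDivisors_iff.2 fun r hr => ?_
    obtain ⟨r, rfl⟩ := hs r
    refine (hπ r).2 (dvd_of_forall_coeff_mul hf fun k => (hπ _).1 ?_)
    have := congrArg (fun p => p.coeff k) hr
    simp only [coeff_smul, coeff_map, smul_eq_mul, coeff_zero] at this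
    rw [mul_comm, map_mul]
    exact this
  have h0 : (f.map C).map π * x.map π = 0 := by
    rw [← Polynomial.map_mul, h, Polynomial.map_mul, map_C, (hπ f).2 dvd_rfl, C_0, zero_mul]
  have h1 := (mul_left_mem_nonZeroDivisors_eq_zero_iff hreg).1 h0
  refine (C_dvd_iff_dvd_coeff f x).2 fun k => (hπ _).1 ?_
  rw [← coeff_map, h1, coeff_zero]

theorem exists_eq_C_mul (hf : IsKoszulGradeTwo (Ideal.span (Set.range f.coeff)))
    {x y : A[X][X]} (h : f.map C * x = C f * y) : ∃ z, x = C f * z :=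
  exists_eq_C_mul_of_surjective (Ideal.Quotient.mk (Ideal.span {f})) Ideal.Quotient.mk_surjective
    (fun z => Ideal.Quotient.eq_zero_iff_dvd f z) hf h

end Polynomial

end KoszulGrade

/-! ### Comparison with Kronecker sequences -/

section GradeTwo

variable {A : Type*} [CommRing A]

theorem IsKoszulGradeTwo.hasGradeGE {I : Ideal A} (hI : IsKoszulGradeTwo I) (hfg : I.FG) :
    HasGradeGE 2 I := by
  obtain ⟨n, a, ha⟩ := Submodule.fg_iff_exists_fin_generating_family.1 hfg
  classical
  let f : Polynomial A := Polynomial.ofFn n a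
  have hf : Ideal.span (Set.range f.coeff) = I := by
    rw [← ha]
    apply le_antisymm
    · refine Ideal.span_le.2 ?_
      rintro _ ⟨k, rfl⟩
      rcases lt_or_ge k n with hk | hk
      · rw [Polynomial.ofFn_coeff_eq_val_of_lt _ hk]
        exact Submodule.subset_span ⟨_, rfl⟩
      · rw [Polynomial.ofFn_coeff_eq_zero_of_ge _ hk]
        exact zero_mem _
    · refine Submodule.span_le.2 ?_
      rintro _ ⟨k, rfl⟩
      exact Ideal.subset_span ⟨k, Polynomial.ofFn_coeff_eq_val_of_lt _ k.2⟩
  let f' : MvPolynomial (Fin 1) A := (MvPolynomial.uniqueAlgEquiv A (Fin 1)).symm f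
  refine ⟨1, fun _ => f', fun _ => ?_, ?_⟩
  · rw [← hf, polyContent]
    congr 1
    ext x
    constructor
    · rintro ⟨d, rfl⟩
      exact ⟨d default, (MvPolynomial.coeff_uniqueAlgEquiv_symm A f d).symm⟩
    · rintro ⟨k, rfl⟩
      refine ⟨Finsupp.single default k, ?_⟩
      exact (MvPolynomial.coeff_uniqueAlgEquiv_symm A f _).trans
        (congrArg _ Finsupp.single_eq_same)
  -- T identifies the ring with A[X][Y], the first variable becoming the inner one.
  · let T : MvPolynomial (Fin 2 × Fin 1) A →ₐ[A] Polynomial (Polynomial A) :=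
      MvPolynomial.aeval fun p =>
        if p.1 = 0 then Polynomial.C Polynomial.X else Polynomial.X
    let T' : Polynomial (Polynomial A) →+* MvPolynomial (Fin 2 × Fin 1) A :=
      Polynomial.eval₂RingHom (Polynomial.eval₂RingHom MvPolynomial.C (MvPolynomial.X (0, 0)))
        (MvPolynomial.X (1, 0))
    have hT'T : ∀ x, T' (T x) = x := by
      have : T'.comp (T : MvPolynomial (Fin 2 × Fin 1) A →+* _) = RingHom.id _ := by
        apply MvPolynomial.ringHom_ext
        · intro r
          simp [T, T']
        · rintro ⟨i, j⟩
          fin_cases i <;> fin_cases j <;> simp [T, T']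
      exact fun x => RingHom.congr_fun this x
    have hTT' : ∀ x, T (T' x) = x := by
      have : (T : MvPolynomial (Fin 2 × Fin 1) A →+* _).comp T' = RingHom.id _ := by
        apply Polynomial.ringHom_ext
        · intro p
          have : ((T : MvPolynomial (Fin 2 × Fin 1) A →+* _).comp T').comp Polynomial.C =
              Polynomial.C := by
            apply Polynomial.ringHom_ext
            · intro r
              simp [T, T']
            · simp [T, T']
          exact RingHom.congr_fun this p
        · simp [T, T']
      exact fun x => RingHom.congr_fun this x
    have hinj : Function.Injective T := Function.LeftInverse.injective hT'T
    have h0 : T (MvPolynomial.rename (fun i => (0, i)) f') = Polynomial.C f := by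
      have : (T.comp ((MvPolynomial.rename fun i : Fin 1 => ((0, i) : Fin 2 × Fin 1)).comp
          (MvPolynomial.uniqueAlgEquiv A (Fin 1)).symm.toAlgHom)).toRingHom =
          Polynomial.C := by
        apply Polynomial.ringHom_ext
        · intro r
          simp [T, MvPolynomial.uniqueAlgEquiv]
        · simp [T, MvPolynomial.uniqueAlgEquiv]
      exact RingHom.congr_fun this f
    have h1 : T (MvPolynomial.rename (fun i => (1, i)) f') = f.map Polynomial.C := by
      have : (T.comp ((MvPolynomial.rename fun i : Fin 1 => ((1, i) : Fin 2 × Fin 1)).comp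
          (MvPolynomial.uniqueAlgEquiv A (Fin 1)).symm.toAlgHom)).toRingHom =
          Polynomial.mapRingHom Polynomial.C := by
        apply Polynomial.ringHom_ext
        · intro r
          simp [T, MvPolynomial.uniqueAlgEquiv]
        · simp [T, MvPolynomial.uniqueAlgEquiv]
      exact RingHom.congr_fun this f
    rw [← hf] at hI
    simp only [List.ofFn_succ, List.ofFn_zero, Fin.succ_zero_eq_one]
    refine (isWeaklyRegular_pair_iff _ _).2 ⟨fun x hx => hinj ?_, fun x y hxy => ?_⟩
    · have hreg := mem_nonZeroDivisors_of_isKoszulGradeTwo hI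
      have := congrArg T hx
      rw [map_mul, h0, map_zero] at this
      ext1 k
      have := congrArg (fun p => p.coeff k) this
      simp only [Polynomial.coeff_C_mul, Polynomial.coeff_zero] at this
      rw [map_zero, Polynomial.coeff_zero]
      exact (mul_left_mem_nonZeroDivisors_eq_zero_iff hreg).1 this
    · have := congrArg T hxy
      rw [map_mul, map_mul, h0, h1] at this
      obtain ⟨z, hz⟩ := exists_eq_C_mul hI this
      exact ⟨T' z, hinj (by rw [map_mul, h0, hTT', hz])⟩

theorem polyContent_fg {σ : Type*} (f : MvPolynomial σ A) : (polyContent f).FG := by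
  have : polyContent f = Ideal.span ((fun d => MvPolynomial.coeff d f) '' f.support) := by
    refine le_antisymm (Ideal.span_le.2 ?_) (Ideal.span_mono (Set.image_subset_range _ _))
    rintro _ ⟨d, rfl⟩
    by_cases hd : d ∈ f.support
    · exact Ideal.subset_span ⟨d, hd, rfl⟩
    · simp only [MvPolynomial.notMem_support_iff.1 hd]
      exact zero_mem _
  rw [this]
  exact Submodule.fg_span (f.support.finite_toSet.image _)

theorem HasGradeGE.fg {I : Ideal A} {k : ℕ} (hk : k ≠ 0) (h : HasGradeGE k I) : I.FG := by
  obtain ⟨m, f, hf, -⟩ := h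
  exact hf ⟨0, Nat.pos_of_ne_zero hk⟩ ▸ polyContent_fg _

/-- The polynomial obtained by applying `w` to the coefficients of `p`. -/
noncomputable def mapCoeff {σ : Type*} (w : A → A) (p : MvPolynomial σ A) : MvPolynomial σ A :=
  ∑ d ∈ p.support, MvPolynomial.monomial d (w (p.coeff d))

theorem coeff_mapCoeff {σ : Type*} (w : A → A) (p : MvPolynomial σ A) {d : σ →₀ ℕ}
    (hd : d ∈ p.support) : (mapCoeff w p).coeff d = w (p.coeff d) := by
  classical
  rw [mapCoeff, MvPolynomial.coeff_sum]
  simp only [MvPolynomial.coeff_monomial, Finset.sum_ite_eq', if_pos hd]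

theorem rename_mul_rename_mapCoeff {σ τ υ : Type*} {w : A → A} (k : σ → υ) (l : τ → υ)
    (p : MvPolynomial σ A) (q : MvPolynomial τ A)
    (hw : ∀ a ∈ polyContent p, ∀ b ∈ polyContent q, a * w b = b * w a) :
    MvPolynomial.rename k p * MvPolynomial.rename l (mapCoeff w q) =
      MvPolynomial.rename l q * MvPolynomial.rename k (mapCoeff w p) := by
  conv_lhs => rw [← MvPolynomial.support_sum_monomial_coeff p]
  conv_rhs => rw [← MvPolynomial.support_sum_monomial_coeff q]
  simp only [mapCoeff, map_sum, MvPolynomial.rename_monomial, Finset.sum_mul_sum,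
    MvPolynomial.monomial_mul]
  rw [Finset.sum_comm]
  refine Finset.sum_congr rfl fun d _ => Finset.sum_congr rfl fun d' _ => ?_
  rw [hw _ (Ideal.subset_span ⟨d', rfl⟩) _ (Ideal.subset_span ⟨d, rfl⟩), add_comm]

/-- Applying w to coefficients gives f₀ w(f₁) = f₁ w(f₀). Regularity yields a common factor h with
w(f₀) = f₀ h and w(f₁) = f₁ h, and the constant term of h is the multiplier. -/
theorem HasGradeGE.isKoszulGradeTwo {I : Ideal A} (h : HasGradeGE 2 I) :
    IsKoszulGradeTwo I := by
  obtain ⟨m, f, hf, hreg⟩ := h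
  simp only [List.ofFn_succ, List.ofFn_zero, Fin.succ_zero_eq_one] at hreg
  obtain ⟨hreg0, hreg1⟩ := (isWeaklyRegular_pair_iff _ _).1 hreg
  have hinj0 : Function.Injective fun i : Fin m => ((0, i) : Fin 2 × Fin m) :=
    Prod.mk_right_injective 0
  have hf0 : ∀ x, f 0 * x = 0 → x = 0 := fun x hx => by
    refine MvPolynomial.rename_injective _ hinj0 ((hreg0 _ ?_).trans (map_zero _).symm)
    rw [← map_mul, hx, map_zero]
  have hann : ∀ x, (∀ a ∈ I, a * x = 0) → x = 0 := fun x hx => by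
    have : f 0 * MvPolynomial.C x = 0 := by
      ext d
      rw [mul_comm, MvPolynomial.coeff_C_mul, mul_comm, MvPolynomial.coeff_zero]
      exact hx _ (hf 0 ▸ Ideal.subset_span ⟨d, rfl⟩)
    simpa using hf0 _ this
  refine ⟨hann, fun w hw => ?_⟩
  let T : MvPolynomial (Fin 2 × Fin m) A →ₐ[A] MvPolynomial (Fin m) (MvPolynomial (Fin m) A) :=
    MvPolynomial.aeval fun p =>
      if p.1 = 0 then MvPolynomial.C (MvPolynomial.X p.2) else MvPolynomial.X p.2
  have hT0 : ∀ p, T (MvPolynomial.rename (fun i => (0, i)) p) = MvPolynomial.C p := by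
    have : (T.comp (MvPolynomial.rename fun i : Fin m => ((0, i) : Fin 2 × Fin m))).toRingHom =
        MvPolynomial.C := by
      apply MvPolynomial.ringHom_ext
      · intro r
        simp [T, MvPolynomial.algebraMap_eq, MvPolynomial.algebraMap_apply]
      · intro i
        simp [T]
    exact fun p => RingHom.congr_fun this p
  have hT1 : ∀ p, T (MvPolynomial.rename (fun i => (1, i)) p) =
      MvPolynomial.map MvPolynomial.C p := by
    have : (T.comp (MvPolynomial.rename fun i : Fin m => ((1, i) : Fin 2 × Fin m))).toRingHom =
        MvPolynomial.map MvPolynomial.C := by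
      apply MvPolynomial.ringHom_ext
      · intro r
        simp [T, MvPolynomial.algebraMap_eq, MvPolynomial.algebraMap_apply]
      · intro i
        simp [T]
    exact fun p => RingHom.congr_fun this p
  have hcomm := rename_mul_rename_mapCoeff (w := w) (fun i => ((0, i) : Fin 2 × Fin m))
    (fun i => ((1, i) : Fin 2 × Fin m)) (f 0) (f 1) (by rw [hf, hf]; exact hw)
  obtain ⟨h, hh0⟩ := hreg1 _ _ hcomm.symm
  have hh1 : MvPolynomial.rename (fun i => ((1, i) : Fin 2 × Fin m)) (mapCoeff w (f 1)) =
      MvPolynomial.rename (fun i => ((1, i) : Fin 2 × Fin m)) (f 1) * h :=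
    sub_eq_zero.1 (hreg0 _ (by rw [mul_sub, hcomm, hh0]; ring))
  replace hh0 := congrArg T hh0
  replace hh1 := congrArg T hh1
  rw [map_mul, hT0, hT0] at hh0
  rw [map_mul, hT1, hT1] at hh1
  -- w(f₀) is free of the second variables and f₀ is regular, so h is free of them too.
  have hTh : T h = MvPolynomial.C ((T h).coeff 0) := by
    ext1 d
    rw [MvPolynomial.coeff_C]
    split_ifs with hd
    · rw [hd]
    · refine hf0 _ ?_
      rw [← MvPolynomial.coeff_C_mul, ← hh0, MvPolynomial.coeff_C, if_neg hd]
  rw [hTh] at hh1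
  set c := ((T h).coeff 0).coeff 0
  have hc : ∀ d ∈ (f 1).support, w ((f 1).coeff d) = (f 1).coeff d * c := fun d hd => by
    have := congrArg (fun p => (p.coeff d).coeff 0) hh1
    rw [mul_comm] at this
    rw [MvPolynomial.coeff_map, MvPolynomial.coeff_C_mul, MvPolynomial.coeff_map, mul_comm,
      MvPolynomial.coeff_C_mul, MvPolynomial.coeff_zero_C, coeff_mapCoeff w _ hd] at this
    exact this
  refine ⟨c, fun y hy => sub_eq_zero.1 (hann _ fun a ha => ?_)⟩
  have : I ≤ LinearMap.ker (LinearMap.mulRight A (w y - c * y)) := by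
    rw [← hf 1]
    refine Ideal.span_le.2 ?_
    rintro _ ⟨d, rfl⟩
    by_cases hd : d ∈ (f 1).support
    · have hm : (f 1).coeff d ∈ I := hf 1 ▸ Ideal.subset_span ⟨d, rfl⟩
      rw [SetLike.mem_coe, LinearMap.mem_ker, LinearMap.mulRight_apply]
      linear_combination hw _ hm y hy + y * hc d hd
    · simp [MvPolynomial.notMem_support_iff.1 hd]
  exact this ha

end GradeTwo

/-! ### MacRae divisors and invariants in short exact sequences -/

section MacRae

variable {A : Type*} [CommRing A]

namespace IsMacRaeDivisor

variable {I : Ideal A} {e : A}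

theorem isKoszulGradeTwo (h : IsMacRaeDivisor I e) :
    IsKoszulGradeTwo (Submodule.comap (LinearMap.mulLeft A e) I) :=
  h.2.2.isKoszulGradeTwo

theorem of_isKoszulGradeTwo (he : e ∈ nonZeroDivisors A) (hI : I ≤ Ideal.span {e}) (hfg : I.FG)
    (h : IsKoszulGradeTwo (Submodule.comap (LinearMap.mulLeft A e) I)) : IsMacRaeDivisor I e := by
  refine ⟨he, hI, h.hasGradeGE ?_⟩
  have hinj : Function.Injective (LinearMap.mulLeft A e) := fun x y hxy =>
    (mul_cancel_left_mem_nonZeroDivisors he).1 hxy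
  -- Multiplication by e is an isomorphism of I/e onto I.
  refine Submodule.fg_of_fg_map_injective _ hinj ?_
  rwa [Submodule.map_comap_eq_of_le]
  intro x hx
  obtain ⟨y, rfl⟩ := Ideal.mem_span_singleton.1 (hI hx)
  exact ⟨y, rfl⟩

theorem mem_span_singleton (h : IsMacRaeDivisor I e) {z : A} (hz : z ∈ nonZeroDivisors A)
    (hI : I ≤ Ideal.span {z}) : e ∈ Ideal.span {z} :=
  h.isKoszulGradeTwo.mem_span_singleton hz fun a ha => hI (mul_comm e a ▸ ha)

end IsMacRaeDivisor

theorem macRaeInvariant_eq_span {E : Type*} [AddCommGroup E] [Module A E] {e : A}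
    (h : IsMacRaeDivisor (fittingIdeal A 0 E) e) : macRaeInvariant A E = Ideal.span {e} := by
  refine le_antisymm (Ideal.span_le.2 fun z hz => ?_)
    (Ideal.span_mono (Set.singleton_subset_iff.2 h))
  exact IsMacRaeDivisor.mem_span_singleton hz h.1 h.2.1

/-- Supplies generators of F₀(G)/c to which Cramer's rule applies directly. -/
theorem span_cofactors_eq_comap {κ : Type*} [Fintype κ] [DecidableEq κ]
    {K : Submodule A (κ → A)} {c : A} (hc : c ∈ nonZeroDivisors A)
    (hK : detIdeal K ≤ Ideal.span {c}) :
    Ideal.span {b | ∃ N : Matrix κ κ A, (∀ j, (fun i => N i j) ∈ K) ∧ N.det = c * b} =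
      Submodule.comap (LinearMap.mulLeft A c) (detIdeal K) := by
  apply le_antisymm
  · refine Ideal.span_le.2 ?_
    rintro b ⟨N, hN, hb⟩
    rw [SetLike.mem_coe, Submodule.mem_comap, LinearMap.mulLeft_apply, ← hb]
    exact det_mem_detIdeal hN
  · intro x hx
    have hle : detIdeal K ≤ Submodule.map (LinearMap.mulLeft A c) (Ideal.span
        {b | ∃ N : Matrix κ κ A, (∀ j, (fun i => N i j) ∈ K) ∧ N.det = c * b}) := by
      refine detIdeal_le fun N hN => ?_
      obtain ⟨b, hb⟩ := Ideal.mem_span_singleton.1 (hK (det_mem_detIdeal hN))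
      exact ⟨b, Ideal.subset_span ⟨N, hN, hb⟩, hb.symm⟩
    obtain ⟨y, hy, hxy⟩ := hle hx
    exact (mul_cancel_left_mem_nonZeroDivisors hc).1 hxy ▸ hy

section ShortExact

variable {E F G : Type*} [AddCommGroup E] [Module A E]
  [AddCommGroup F] [Module A F] [AddCommGroup G] [Module A G]
  [Module.FinitePresentation A E] [Module.FinitePresentation A F] [Module.FinitePresentation A G]
  {f : E →ₗ[A] F} {g : F →ₗ[A] G}

theorem exists_compatible_generators (hfg : Function.Exact f g) (hg : Function.Surjective g) :
    ∃ (m n : ℕ) (p : (Fin m → A) →ₗ[A] E) (p' : (Fin n → A) →ₗ[A] F),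
      Function.Surjective p ∧
      fittingIdeal A 0 E = detIdeal (LinearMap.ker p) ∧
      fittingIdeal A 0 F = detIdeal (LinearMap.ker (joinMap (f ∘ₗ p) p')) ∧
      fittingIdeal A 0 G = detIdeal (LinearMap.ker (g ∘ₗ p')) := by
  obtain ⟨m, p, hp⟩ := Module.Finite.exists_fin' A E
  obtain ⟨n, q, hq⟩ := Module.Finite.exists_fin' A G
  obtain ⟨p', rfl⟩ := Module.projective_lifting_property g q hg
  exact ⟨m, n, p, p', hp, fittingIdeal_zero_eq p hp,
    fittingIdeal_zero_eq _ (joinMap_surjective hfg p p' hp hq), fittingIdeal_zero_eq _ hq⟩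

theorem fittingIdeal_le_of_exact (hfg : Function.Exact f g) (hg : Function.Surjective g) :
    fittingIdeal A 0 F ≤ fittingIdeal A 0 G := by
  obtain ⟨m, n, p, p', hp, -, hF, hG⟩ := exists_compatible_generators hfg hg
  rw [hF, hG]
  exact detIdeal_ker_joinMap_le hfg p p'

theorem fittingIdeal_mul_le_of_exact (hfg : Function.Exact f g) (hg : Function.Surjective g) :
    fittingIdeal A 0 E * fittingIdeal A 0 G ≤ fittingIdeal A 0 F := by
  obtain ⟨m, n, p, p', hp, hE, hF, hG⟩ := exists_compatible_generators hfg hg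
  rw [hE, hF, hG]
  exact detIdeal_ker_mul_le hfg p hp p'

theorem exists_pow_mul_eq_of_exact (hf : Function.Injective f) (hfg : Function.Exact f g)
    (hg : Function.Surjective g) {c : A} (hc : c ∈ nonZeroDivisors A)
    (hG : fittingIdeal A 0 G ≤ Ideal.span {c}) :
    ∃ (S : Set A) (n : ℕ),
      Ideal.span S = Submodule.comap (LinearMap.mulLeft A c) (fittingIdeal A 0 G) ∧
        ∀ b ∈ S, ∀ x ∈ fittingIdeal A 0 F, ∃ d ∈ fittingIdeal A 0 E, b ^ n * x = c * b * d := by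
  obtain ⟨m, n, p, p', hp, hE', hF', hG'⟩ := exists_compatible_generators hfg hg
  rw [hG'] at hG ⊢
  rw [hE', hF']
  refine ⟨_, Fintype.card (Fin m ⊕ Fin n), span_cofactors_eq_comap hc hG, ?_⟩
  rintro b ⟨N, hN, hb⟩ x hx
  induction hx using Submodule.span_induction with
  | mem x hx =>
    obtain ⟨M, hM, rfl⟩ := hx
    exact pow_mul_det_mem hf hfg p hp p' hc hG hN hb hM
  | zero => exact ⟨0, zero_mem _, by simp⟩
  | add x y _ _ hx hy =>
    obtain ⟨d, hd, hx⟩ := hx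
    obtain ⟨d', hd', hy⟩ := hy
    exact ⟨d + d', add_mem hd hd', by rw [mul_add, hx, hy, mul_add]⟩
  | smul a x _ hx =>
    obtain ⟨d, hd, hx⟩ := hx
    exact ⟨a * d, Ideal.mul_mem_left _ _ hd, by rw [smul_eq_mul]; linear_combination a * hx⟩

/-- Cancelling the ideal of the bⁿ in bⁿ F₀(F) ⊆ (e c) gives F₀(F) ⊆ (e c), while F₀(F)/(e c)
contains (F₀(E)/e)(F₀(G)/c). -/
theorem IsMacRaeDivisor.mul_of_exact (hf : Function.Injective f) (hfg : Function.Exact f g)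
    (hg : Function.Surjective g) {e c : A} (he : IsMacRaeDivisor (fittingIdeal A 0 E) e)
    (hc : IsMacRaeDivisor (fittingIdeal A 0 G) c) :
    IsMacRaeDivisor (fittingIdeal A 0 F) (e * c) := by
  have hec := mul_mem he.1 hc.1
  obtain ⟨S, n, hS, hmul⟩ := exists_pow_mul_eq_of_exact hf hfg hg hc.1 hc.2.1
  refine of_isKoszulGradeTwo hec (fun x hx => ?_) (fittingIdeal_zero_fg A F) ?_
  · have hSn := IsKoszulGradeTwo.span_pow (hS ▸ hc.isKoszulGradeTwo)
      (hS ▸ hc.2.2.fg two_ne_zero) n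
    refine hSn.mem_span_singleton hec fun a ha => ?_
    have hle : Ideal.span ((· ^ n) '' S) ≤
        Submodule.comap (LinearMap.mulRight A x) (Ideal.span {e * c}) := by
      refine Ideal.span_le.2 ?_
      rintro _ ⟨b, hb, rfl⟩
      obtain ⟨d, hd, hbd⟩ := hmul b hb x hx
      obtain ⟨d', rfl⟩ := Ideal.mem_span_singleton.1 (he.2.1 hd)
      exact Ideal.mem_span_singleton.2 ⟨b * d', hbd.trans (by ring)⟩
    exact hle ha
  · refine (he.isKoszulGradeTwo.mul hc.isKoszulGradeTwo).mono (Ideal.mul_le.2 fun x hx y hy => ?_)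
    have := fittingIdeal_mul_le_of_exact hfg hg (Ideal.mul_mem_mul hx hy)
    rw [LinearMap.mulLeft_apply, LinearMap.mulLeft_apply] at this
    rwa [Submodule.mem_comap, LinearMap.mulLeft_apply, mul_mul_mul_comm]

/-- F₀(F) ⊆ F₀(G) ⊆ (c) forces a = c e. Cancelling F₀(G)/c gives F₀(E) ⊆ (e), and F₀(E)/e contains
the product of F₀(F)/a with the ideal of the bⁿ. -/
theorem IsMacRaeDivisor.exists_left_of_exact (hf : Function.Injective f)
    (hfg : Function.Exact f g) (hg : Function.Surjective g) {a c : A}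
    (ha : IsMacRaeDivisor (fittingIdeal A 0 F) a) (hc : IsMacRaeDivisor (fittingIdeal A 0 G) c) :
    ∃ e, IsMacRaeDivisor (fittingIdeal A 0 E) e := by
  obtain ⟨e, rfl⟩ := Ideal.mem_span_singleton.1
    (ha.mem_span_singleton hc.1 ((fittingIdeal_le_of_exact hfg hg).trans hc.2.1))
  have he : e ∈ nonZeroDivisors A := (mul_mem_nonZeroDivisors.1 ha.1).2
  obtain ⟨S, n, hS, hmul⟩ := exists_pow_mul_eq_of_exact hf hfg hg hc.1 hc.2.1
  refine ⟨e, of_isKoszulGradeTwo he (fun d hd => ?_) (fittingIdeal_zero_fg A E) ?_⟩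
  · refine hc.isKoszulGradeTwo.mem_span_singleton he fun x hx => ?_
    have := ha.2.1 (fittingIdeal_mul_le_of_exact hfg hg (Ideal.mul_mem_mul hd hx))
    obtain ⟨t, ht⟩ := Ideal.mem_span_singleton.1 this
    rw [LinearMap.mulLeft_apply] at ht
    exact Ideal.mem_span_singleton.2 ⟨t, (mul_cancel_left_mem_nonZeroDivisors hc.1).1
      (by linear_combination ht)⟩
  · have hSn := IsKoszulGradeTwo.span_pow (hS ▸ hc.isKoszulGradeTwo)
      (hS ▸ hc.2.2.fg two_ne_zero) n
    refine (ha.isKoszulGradeTwo.mul hSn).mono (Ideal.mul_le.2 fun x hx y hy => ?_)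
    have hle : Ideal.span ((· ^ n) '' S) ≤
        Submodule.comap (LinearMap.mulRight A (e * x)) (fittingIdeal A 0 E) := by
      refine Ideal.span_le.2 ?_
      rintro _ ⟨b, hb, rfl⟩
      obtain ⟨d, hd, hbd⟩ := hmul b hb _ hx
      rw [LinearMap.mulLeft_apply] at hbd
      have : b ^ n * (e * x) = b * d := (mul_cancel_left_mem_nonZeroDivisors hc.1).1
        (by linear_combination hbd)
      simp only [SetLike.mem_coe, Submodule.mem_comap, LinearMap.mulRight_apply, this]
      exact Ideal.mul_mem_left _ b hd
    have := hle hy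
    rw [Submodule.mem_comap, LinearMap.mulRight_apply] at this
    rw [Submodule.mem_comap, LinearMap.mulLeft_apply]
    convert this using 1
    ring

theorem IsMacRaeModule.of_exact (hf : Function.Injective f) (hfg : Function.Exact f g)
    (hg : Function.Surjective g) (hE : IsMacRaeModule A E) (hG : IsMacRaeModule A G) :
    IsMacRaeModule A F ∧ macRaeInvariant A E * macRaeInvariant A G = macRaeInvariant A F := by
  obtain ⟨-, -, e, he⟩ := hE
  obtain ⟨-, -, c, hc⟩ := hG
  have h := he.mul_of_exact hf hfg hg hc
  refine ⟨⟨inferInstance, fittingIdeal_zero_fg A F, _, h⟩, ?_⟩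
  rw [macRaeInvariant_eq_span he, macRaeInvariant_eq_span hc, macRaeInvariant_eq_span h,
    Ideal.span_singleton_mul_span_singleton]

theorem IsMacRaeModule.left_of_exact (hf : Function.Injective f) (hfg : Function.Exact f g)
    (hg : Function.Surjective g) (hF : IsMacRaeModule A F) (hG : IsMacRaeModule A G) :
    IsMacRaeModule A E := by
  obtain ⟨-, -, a, ha⟩ := hF
  obtain ⟨-, -, c, hc⟩ := hG
  exact ⟨inferInstance, fittingIdeal_zero_fg A E, ha.exists_left_of_exact hf hfg hg hc⟩

end ShortExact

end MacRae

/-! ### Long exact sequences -/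

section LongExact

theorem prod_even_eq_prod_odd {M : Type*} [CommMonoid M] (e k : ℕ → M) (m : ℕ)
    (h0 : k 0 * e 0 = e 1) (h : ∀ i, i < m → k (i + 1) * k i = e (i + 2)) :
    ∏ i ∈ Finset.range (m + 3) with Even i, (if i = m + 2 then k m else e i) =
      ∏ i ∈ Finset.range (m + 3) with Odd i, (if i = m + 2 then k m else e i) := by
  -- The truncated identity has the kernel `k j` standing in for the term of index j + 2; the
  -- induction only multiplies by `k (j + 1)`, with no cancellation.
  have key : ∀ j, j ≤ m →
      (∏ i ∈ Finset.range (j + 2), if Even i then e i else 1) * (if Even j then k j else 1) =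
        (∏ i ∈ Finset.range (j + 2), if Odd i then e i else 1) *
          (if Even j then 1 else k j) := by
    intro j
    induction j with
    | zero => intro _; simp [Finset.prod_range_succ, ← h0, mul_comm]
    | succ j ih =>
      intro hj
      replace ih := ih (by omega)
      rw [Finset.prod_range_succ, Finset.prod_range_succ _ (j + 2), ← h j (by omega)]
      by_cases hj' : Even j
      · have h1 : ¬ Even (j + 1) := by rwa [Nat.even_add_one, not_not]
        have h2 : Even (j + 2) := by rw [Nat.even_add_one]; exact h1
        simp only [hj', h1, h2, if_true, if_false, mul_one, Nat.not_odd_iff_even.2 h2] at ih ⊢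
        rw [← ih, mul_comm (k (j + 1)), mul_assoc]
      · have h1 : Even (j + 1) := by rwa [Nat.even_add_one]
        have h2 : ¬ Even (j + 2) := by rw [Nat.even_add_one, not_not]; exact h1
        simp only [hj', h1, h2, if_true, if_false, mul_one, Nat.not_even_iff_odd.1 h2] at ih ⊢
        rw [ih, mul_comm (k (j + 1)), mul_assoc]
  have hne : ∀ p : ℕ → Prop, [DecidablePred p] →
      (∏ i ∈ Finset.range (m + 2), if p i then (if i = m + 2 then k m else e i) else 1) =
        ∏ i ∈ Finset.range (m + 2), if p i then e i else 1 := fun p _ =>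
    Finset.prod_congr rfl fun i hi => by rw [if_neg (Finset.mem_range.1 hi).ne]
  rw [Finset.prod_filter, Finset.prod_filter, Finset.prod_range_succ,
    Finset.prod_range_succ _ (m + 2), if_pos rfl, hne, hne]
  convert key m le_rfl using 2
  · simp [Nat.even_add]
  · simp [← Nat.not_even_iff_odd, Nat.even_add]

variable {A : Type*} [CommRing A]

section Kernel

variable {E F G : Type*} [AddCommGroup E] [Module A E] [AddCommGroup F] [Module A F]
  [AddCommGroup G] [Module A G] {u : E →ₗ[A] F} {v : F →ₗ[A] G}

theorem mem_ker_of_exact (h : Function.Exact u v) (x : E) : u x ∈ LinearMap.ker v :=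
  h.apply_apply_eq_zero x

theorem codRestrict_ker_surjective (h : Function.Exact u v) :
    Function.Surjective (u.codRestrict (LinearMap.ker v) (mem_ker_of_exact h)) := by
  rintro ⟨y, hy⟩
  obtain ⟨x, rfl⟩ := (h y).1 hy
  exact ⟨x, rfl⟩

theorem exact_subtype_codRestrict_ker (h : Function.Exact u v) :
    Function.Exact (LinearMap.ker u).subtype
      (u.codRestrict (LinearMap.ker v) (mem_ker_of_exact h)) := by
  rw [LinearMap.exact_iff, LinearMap.ker_codRestrict, Submodule.range_subtype]

theorem finite_ker_of_exact [Module.Finite A E] (h : Function.Exact u v) :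
    Module.Finite A (LinearMap.ker v) :=
  Module.Finite.of_surjective _ (codRestrict_ker_surjective h)

theorem finitePresentation_ker_of_exact [Module.FinitePresentation A E] (h : Function.Exact u v)
    [hu : Module.Finite A (LinearMap.ker u)] :
    Module.FinitePresentation A (LinearMap.ker v) := by
  refine Module.finitePresentation_of_surjective _ (codRestrict_ker_surjective h) ?_
  rw [LinearMap.ker_codRestrict]
  exact Module.Finite.iff_fg.1 hu

theorem IsMacRaeModule.ker_of_exact (h : Function.Exact u v)
    [Module.FinitePresentation A (LinearMap.ker u)] (hE : IsMacRaeModule A E)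
    (hv : IsMacRaeModule A (LinearMap.ker v)) :
    IsMacRaeModule A (LinearMap.ker u) ∧
      macRaeInvariant A (LinearMap.ker u) * macRaeInvariant A (LinearMap.ker v) =
        macRaeInvariant A E := by
  have := hE.1
  have := hv.1
  have hu := IsMacRaeModule.left_of_exact (Submodule.subtype_injective _)
    (exact_subtype_codRestrict_ker h) (codRestrict_ker_surjective h) hE hv
  exact ⟨hu, (IsMacRaeModule.of_exact (Submodule.subtype_injective _)
    (exact_subtype_codRestrict_ker h) (codRestrict_ker_surjective h) hu hv).2⟩

theorem IsMacRaeModule.ker_of_surjective (h : Function.Surjective u)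
    [Module.FinitePresentation A (LinearMap.ker u)] (hE : IsMacRaeModule A E)
    (hF : IsMacRaeModule A F) :
    IsMacRaeModule A (LinearMap.ker u) ∧
      macRaeInvariant A (LinearMap.ker u) * macRaeInvariant A F = macRaeInvariant A E := by
  have := hE.1
  have := hF.1
  have hex : Function.Exact (LinearMap.ker u).subtype u := by
    rw [LinearMap.exact_iff, Submodule.range_subtype]
  have hu := IsMacRaeModule.left_of_exact (Submodule.subtype_injective _) hex h hE hF
  exact ⟨hu, (IsMacRaeModule.of_exact (Submodule.subtype_injective _) hex h hu hF).2⟩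

end Kernel

variable {E : ℕ → Type*} [∀ i, AddCommGroup (E i)] [∀ i, Module A (E i)]
  {u : ∀ i, E (i + 1) →ₗ[A] E i} {m : ℕ}

theorem isMacRaeModule_ker (hE : ∀ i, i < m + 2 → IsMacRaeModule A (E i))
    (h0 : Function.Surjective (u 0)) (hex : ∀ i, i < m → Function.Exact (u (i + 1)) (u i))
    (j : ℕ) (hj : j ≤ m)
    (hfp : ∀ i, i ≤ j → Module.FinitePresentation A (LinearMap.ker (u i))) :
    IsMacRaeModule A (LinearMap.ker (u j)) := by
  induction j with
  | zero =>
    have := hfp 0 le_rfl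
    exact (IsMacRaeModule.ker_of_surjective h0 (hE 1 (by omega)) (hE 0 (by omega))).1
  | succ j ih =>
    have := hfp (j + 1) le_rfl
    exact (IsMacRaeModule.ker_of_exact (hex j (by omega)) (hE (j + 2) (by omega))
      (ih (by omega) fun i hi => hfp i (by omega))).1

end LongExact

theorem mainTheorem12 {A : Type*} [CommRing A] :
    -- short exact sequences `0 → E → F → G → 0` of finitely presented modules
    (∀ (E : Type*) (F : Type*) (G : Type*)
        [AddCommGroup E] [Module A E] [AddCommGroup F] [Module A F] [AddCommGroup G] [Module A G]
        [Module.FinitePresentation A E] [Module.FinitePresentation A F]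
        [Module.FinitePresentation A G]
        (f : E →ₗ[A] F) (g : F →ₗ[A] G),
        Function.Injective f → Function.Exact f g → Function.Surjective g →
          (IsMacRaeModule A E → IsMacRaeModule A G →
            IsMacRaeModule A F ∧
              macRaeInvariant A E * macRaeInvariant A G = macRaeInvariant A F) ∧
          (IsMacRaeModule A F → IsMacRaeModule A G → IsMacRaeModule A E)) ∧
    -- exact sequences `E (n - 1) → ⋯ → E 1 → E 0 → 0` of MacRae modules, where `n ≥ 2` and
    -- the maps are `u i : E (i + 1) → E i` for `i + 1 < n` (nothing is asked beyond that range)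
    (∀ (n : ℕ) (_ : 2 ≤ n) (E : ℕ → Type*)
        [∀ i, AddCommGroup (E i)] [∀ i, Module A (E i)]
        (u : ∀ i, E (i + 1) →ₗ[A] E i),
        (∀ i, i < n → IsMacRaeModule A (E i)) →
        Function.Surjective (u 0) →
        (∀ i, i + 2 < n → Function.Exact (u (i + 1)) (u i)) →
          -- all kernels but the last two are MacRae without further assumption
          (∀ i, i + 3 < n → IsMacRaeModule A (LinearMap.ker (u i))) ∧
          -- everything holds when the last kernel `E_n = ker (u (n - 2))` is finitely presented
          (Module.FinitePresentation A (LinearMap.ker (u (n - 2))) →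
            (∀ i, i + 1 < n → IsMacRaeModule A (LinearMap.ker (u i))) ∧
            ∏ i ∈ Finset.range (n + 1) with Even i,
                (if i = n then macRaeInvariant A (LinearMap.ker (u (n - 2)))
                  else macRaeInvariant A (E i)) =
              ∏ i ∈ Finset.range (n + 1) with Odd i,
                (if i = n then macRaeInvariant A (LinearMap.ker (u (n - 2)))
                  else macRaeInvariant A (E i)))) := by

  refine ⟨?_, ?_⟩
  · intro E F G _ _ _ _ _ _ _ _ _ f g hf hfg hg
    exact ⟨IsMacRaeModule.of_exact hf hfg hg, IsMacRaeModule.left_of_exact hf hfg hg⟩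
  · intro n hn E _ _ u hE h0 hex
    obtain ⟨m, rfl⟩ := Nat.exists_eq_add_of_le' hn
    have hex' : ∀ i, i < m → Function.Exact (u (i + 1)) (u i) := fun i hi => hex i (by omega)
    have hfin : ∀ i, i < m → Module.Finite A (LinearMap.ker (u i)) := fun i hi => by
      have := (hE (i + 2) (by omega)).1
      exact finite_ker_of_exact (hex' i hi)
    have hfp : ∀ i, i < m → Module.Finite A (LinearMap.ker (u (i + 1))) →
        Module.FinitePresentation A (LinearMap.ker (u i)) := fun i hi _ => by
      have := (hE (i + 2) (by omega)).1
      exact finitePresentation_ker_of_exact (hex' i hi)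
    refine ⟨fun i hi => isMacRaeModule_ker hE h0 hex' i (by omega) fun j hj =>
      hfp j (by omega) (hfin _ (by omega)), fun hm => ?_⟩
    have hm' : Module.FinitePresentation A (LinearMap.ker (u m)) := hm
    -- Finite presentation of ker (u i) needs only finite generation of ker (u (i + 1)): automatic
    -- for i + 1 < m, and given by the extra hypothesis for i + 1 = m.
    have hfp' : ∀ i, i ≤ m → Module.FinitePresentation A (LinearMap.ker (u i)) := fun i hi => by
      rcases hi.eq_or_lt with rfl | hi
      · exact hm'
      · refine hfp i hi ?_
        rcases (Nat.succ_le_of_lt hi).eq_or_lt with h | h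
        · subst h
          infer_instance
        · exact hfin _ h
    have hker : ∀ i, i ≤ m → IsMacRaeModule A (LinearMap.ker (u i)) := fun i hi =>
      isMacRaeModule_ker hE h0 hex' i hi fun j hj => hfp' j (hj.trans hi)
    refine ⟨fun i hi => hker i (by omega), ?_⟩
    refine prod_even_eq_prod_odd (fun i => macRaeInvariant A (E i))
      (fun i => macRaeInvariant A (LinearMap.ker (u i))) m ?_ fun i hi => ?_
    · have := hfp' 0 (Nat.zero_le m)
      exact (IsMacRaeModule.ker_of_surjective h0 (hE 1 (by omega)) (hE 0 (by omega))).2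
    · have := hfp' (i + 1) hi
      exact (IsMacRaeModule.ker_of_exact (hex' i hi) (hE (i + 2) (by omega)) (hker i hi.le)).2
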